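/- Let $k\ge 1$ be an integer and let $\mathbb{F}_q$ be the finite field with $q$ elements. Suppose that $-1$ is a $k$-th power in $\mathbb{F}_q$, and let $G=\mathrm{Paley}_k(\mathbb{F}_q)$ be the generalized Paley graph: its vertex set is $\mathbb{F}_q$, and two distinct vertices $x,y$ are adjacent if and only if $x-y=z^k$ for some $z\in\mathbb{F}_q$ (this graph is undirected because $-1$ is a $k$-th power). Let $$\vartheta(G)=\inf_{(u_v),\,c}\ \max_{v}\ \frac{1}{\langle c,u_v\rangle^2}$$ be the Lovász theta function of $G$, where $(u_v)_{v\in\mathbb{F}_q}$ runs over all orthonormal representations of $G$ (families of unit vectors in some Euclidean space $\mathbb{R}^d$ such that $\langle u_v,u_w\rangle=0$ whenever $v\ne w$ are not adjacent), $c$ runs over all unit vectors of the same space, and $1/0=\infty$. Then $$\vartheta(G)\le q^{1-\frac1k}.$$ Consequently $$\alpha(G\boxtimes G)\le q^{2\left(1-\frac1k\right)},$$ where $\alpha$ denotes the largest size of a set of pairwise nonadjacent vertices, and $G\boxtimes G$ is the strong product: its vertex set is $\mathbb{F}_q\times\mathbb{F}_q$, and two distinct vertices $(v,v')$ and $(u,u')$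 are adjacent if and only if $v,u$ are equal or adjacent in $G$ and $v',u'$ are equal or adjacent in $G$. -/

import Mathlib

/-- The generalized Paley graph `Paley_k(R)`: `x` and `y` are joined when they are distinct and
`x - y` is a `k`-th power. The hypothesis that `-1` is a `k`-th power makes it undirected. -/
def generalizedPaleyGraph (k : ℕ) (R : Type*) [CommRing R] (h : ∃ z : R, z ^ k = -1) :
    SimpleGraph R where
  Adj x y := x ≠ y ∧ ∃ z : R, x - y = z ^ k
  symm := ⟨by
    obtain ⟨w, hw⟩ := h
    rintro x y ⟨hxy, z, hz⟩
    exact ⟨hxy.symm, w * z, by rw [mul_pow, hw, ← hz]; ring⟩⟩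
  loopless := ⟨fun _ hx => hx.1 rfl⟩

/-- The strong product of two graphs. -/
def strongProduct {V W : Type*} (G : SimpleGraph V) (H : SimpleGraph W) :
    SimpleGraph (V × W) where
  Adj p q := (G.Adj p.1 q.1 ∧ H.Adj p.2 q.2) ∨ (G.Adj p.1 q.1 ∧ p.2 = q.2) ∨
    (p.1 = q.1 ∧ H.Adj p.2 q.2)
  symm := ⟨by
    rintro p q (⟨h₁, h₂⟩ | ⟨h₁, h₂⟩ | ⟨h₁, h₂⟩)
    · exact Or.inl ⟨h₁.symm, h₂.symm⟩
    · exact Or.inr (Or.inl ⟨h₁.symm, h₂.symm⟩)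
    · exact Or.inr (Or.inr ⟨h₁.symm, h₂.symm⟩)⟩
  loopless := ⟨by
    rintro p (⟨h, -⟩ | ⟨h, -⟩ | ⟨-, h⟩)
    · exact G.loopless.irrefl _ h
    · exact G.loopless.irrefl _ h
    · exact H.loopless.irrefl _ h⟩

/-- An orthonormal representation of `G` in `ℝ^d`: a unit vector for every vertex, such that
distinct nonadjacent vertices get orthogonal vectors. -/
def IsOrthonormalRepresentation {V : Type*} (G : SimpleGraph V) {d : ℕ}
    (u : V → EuclideanSpace ℝ (Fin d)) : Prop :=
  (∀ v, ‖u v‖ = 1) ∧ ∀ v w, v ≠ w → ¬ G.Adj v w → inner ℝ (u v) (u w) = 0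

/-- The Lovász theta function: the infimum, over all orthonormal representations `u` of `G` in
Euclidean spaces of arbitrary finite dimension and all unit vectors `c` (the handle), of
`max_v 1 / ⟨c, u v⟩ ^ 2`. It is taken in `[0, ∞]`, where `1 / 0 = ∞`. -/
noncomputable def lovaszTheta {V : Type*} (G : SimpleGraph V) : ENNReal :=
  ⨅ (d : ℕ) (u : V → EuclideanSpace ℝ (Fin d)) (_ : IsOrthonormalRepresentation G u)
    (c : EuclideanSpace ℝ (Fin d)) (_ : ‖c‖ = 1),
    ⨆ v : V, (ENNReal.ofReal (inner ℝ c (u v) ^ 2))⁻¹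

open Finset

/-! Let `H` be the group of nonzero `k`-th powers and `r` its order. `G` is the Cayley graph of `H`,
so its adjacency matrix `A` has the Gaussian periods as eigenvalues, the trivial character giving
`r`. Let `-m` be the least one. Then `I + A / m` is positive semidefinite, has unit diagonal and
vanishes at nonadjacent pairs: it is the Gram matrix of an orthonormal representation. A handle
along the trivial character gives it the value `q / (1 + r / m)`.

It remains to see that `q ≤ (1 + r / m) ^ k`, which is `card_mul_pow_index_le` together with
`H.index ≤ k`. A product of shifted periods, one for each coset of `H`, vanishes off `0` and equals
`(m + r) ^ H.index` at `0`. Its trivial Fourier coefficient is at least `m ^ H.index`, because all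
coefficients of the factors are nonnegative. Summing over the field compares the two. -/

/-- The Gaussian period of a subgroup `H` of the units of `R`, in real form: the sum of the real
parts of `ψ (b * h)` over `h ∈ H`. -/
noncomputable def gaussianPeriod {R : Type*} [CommRing R] [Fintype R] (ψ : AddChar R ℂ)
    (H : Subgroup Rˣ) (b : R) : ℝ :=
  ∑ᶠ h : H, (ψ (b * ((h : Rˣ) : R))).re

/-! ### Positive combinations of characters -/

/-- `f` is a combination, with nonnegative coefficients, of the characters `x ↦ ψ (c * x)`, in
which the coefficient of the trivial character is at least `a`. -/
def IsPositiveCombination {R : Type*} [CommRing R] [Fintype R] (ψ : AddChar R ℂ)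
    (f : R → ℂ) (a : ℝ) : Prop :=
  ∃ w : R → ℝ, (∀ c, 0 ≤ w c) ∧ a ≤ w 0 ∧ ∀ x, f x = ∑ c, (w c : ℂ) * ψ (c * x)

namespace IsPositiveCombination

variable {R : Type*} [CommRing R] [Fintype R] {ψ : AddChar R ℂ} {f g : R → ℂ} {a b : ℝ}

theorem char (c : R) : IsPositiveCombination ψ (fun x => ψ (c * x)) 0 := by
  classical
  refine ⟨Pi.single c 1, fun d => ?_, ?_, fun x => ?_⟩
  · by_cases h : d = c
    · subst h; simp
    · simp [h]
  · by_cases h : (0 : R) = c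
    · subst h; simp
    · simp [h]
  · rw [sum_eq_single c] <;> simp +contextual

theorem const (ha : 0 ≤ a) : IsPositiveCombination ψ (fun _ => (a : ℂ)) a := by
  classical
  refine ⟨Pi.single 0 a, fun d => ?_, by simp, fun x => ?_⟩
  · by_cases h : d = 0
    · subst h; simpa
    · simp [h]
  · rw [sum_eq_single 0] <;> simp +contextual

theorem add (hf : IsPositiveCombination ψ f a) (hg : IsPositiveCombination ψ g b) :
    IsPositiveCombination ψ (fun x => f x + g x) (a + b) := by
  obtain ⟨v, hv, hv0, hfv⟩ := hf
  obtain ⟨w, hw, hw0, hgw⟩ := hg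
  refine ⟨v + w, fun c => _root_.add_nonneg (hv c) (hw c), add_le_add hv0 hw0, fun x => ?_⟩
  simp [hfv, hgw, add_mul, sum_add_distrib]

theorem sum {ι : Type*} (s : Finset ι) {f : ι → R → ℂ}
    (hf : ∀ i ∈ s, IsPositiveCombination ψ (f i) 0) :
    IsPositiveCombination ψ (fun x => ∑ i ∈ s, f i x) 0 := by
  classical
  induction s using Finset.induction_on with
  | empty => simpa using const (ψ := ψ) le_rfl
  | insert i s hi ih =>
    simp only [sum_insert hi]
    simpa using (hf i (by simp)).add (ih fun j hj => hf j (by simp [hj]))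

/-- Coefficients convolve under multiplication; nonnegativity allows all terms but `v 0 * w 0` to be
dropped at the trivial character. -/
theorem mul (hb : 0 ≤ b) (hf : IsPositiveCombination ψ f a)
    (hg : IsPositiveCombination ψ g b) :
    IsPositiveCombination ψ (fun x => f x * g x) (a * b) := by
  obtain ⟨v, hv, hv0, hfv⟩ := hf
  obtain ⟨w, hw, hw0, hgw⟩ := hg
  refine ⟨fun c => ∑ d, v d * w (c - d), fun c => sum_nonneg fun d _ => mul_nonneg (hv d) (hw _),
    ?_, fun x => ?_⟩
  · calc a * b ≤ v 0 * w (0 - 0) := by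
          rw [sub_zero]; exact mul_le_mul hv0 hw0 hb (hv 0)
      _ ≤ _ := single_le_sum (f := fun d => v d * w (0 - d))
          (fun d _ => mul_nonneg (hv d) (hw _)) (mem_univ 0)
  · simp only [hfv, hgw, sum_mul, Complex.ofReal_sum, Complex.ofReal_mul]
    rw [sum_comm]
    refine sum_congr rfl fun d _ => ?_
    rw [mul_sum]
    refine Fintype.sum_equiv (Equiv.addRight d) _ _ fun c => ?_
    simp only [Equiv.coe_addRight, add_sub_cancel_right, add_mul, AddChar.map_add_eq_mul]
    ring

theorem prod {ι : Type*} (s : Finset ι) {f : ι → R → ℂ} (ha : 0 ≤ a)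
    (hf : ∀ i ∈ s, IsPositiveCombination ψ (f i) a) :
    IsPositiveCombination ψ (fun x => ∏ i ∈ s, f i x) (a ^ #s) := by
  classical
  induction s using Finset.induction_on with
  | empty => simpa using const (ψ := ψ) zero_le_one
  | insert i s hi ih =>
    simp only [prod_insert hi, card_insert_of_notMem hi, pow_succ']
    exact mul (pow_nonneg ha _) (hf i (by simp)) (ih fun j hj => hf j (by simp [hj]))

/-- The sum of all values of a positive combination is `card R` times the coefficient of the trivial
character. -/
theorem card_mul_le_re_sum (hψ : ψ.IsPrimitive) (hf : IsPositiveCombination ψ f a) :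
    Fintype.card R * a ≤ (∑ x, f x).re := by
  classical
  obtain ⟨w, -, hw0, hfw⟩ := hf
  have : ∑ x, f x = ((Fintype.card R * w 0 : ℝ) : ℂ) := by
    simp only [hfw]
    rw [sum_comm]
    simp only [← mul_sum]
    have h (c : R) : ∑ x, ψ (c * x) = if c = 0 then (Fintype.card R : ℂ) else 0 := by
      have := AddChar.sum_mulShift c hψ
      push_cast at this
      rw [← this]
      simp only [mul_comm]
    simp [h, mul_comm]
  rw [this, Complex.ofReal_re]
  exact mul_le_mul_of_nonneg_left hw0 (Nat.cast_nonneg _)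

end IsPositiveCombination

/-! ### Gaussian periods -/

section GaussianPeriod

variable {F : Type*} [Field F] [Fintype F] {ψ : AddChar F ℂ} {H : Subgroup Fˣ}

theorem gaussianPeriod_zero : gaussianPeriod ψ H 0 = Nat.card H := by
  classical
  rw [gaussianPeriod, finsum_eq_sum_of_fintype]
  simp

theorem gaussianPeriod_mul {h : Fˣ} (hh : h ∈ H) (b : F) :
    gaussianPeriod ψ H (b * h) = gaussianPeriod ψ H b := by
  classical
  simp only [gaussianPeriod, finsum_eq_sum_of_fintype]
  refine Fintype.sum_equiv (Equiv.mulLeft ⟨h, hh⟩) _ _ fun g => ?_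
  simp [mul_assoc]

/-- Conjugation replaces `h` by `-h`, which only permutes `H`. -/
theorem ofReal_gaussianPeriod (hH : -1 ∈ H) (b : F) :
    (gaussianPeriod ψ H b : ℂ) = ∑ᶠ h : H, ψ (b * ((h : Fˣ) : F)) := by
  classical
  simp only [gaussianPeriod, finsum_eq_sum_of_fintype]
  rw [← Complex.re_sum]
  refine Complex.conj_eq_iff_re.1 ?_
  rw [map_sum]
  refine Fintype.sum_equiv (Equiv.mulLeft ⟨-1, hH⟩) _ _ fun g => ?_
  simp [AddChar.map_neg_eq_conj]

theorem sum_gaussianPeriod (hψ : ψ.IsPrimitive) : ∑ b, gaussianPeriod ψ H b = 0 := by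
  classical
  simp only [gaussianPeriod, finsum_eq_sum_of_fintype]
  rw [sum_comm]
  refine sum_eq_zero fun h _ => ?_
  rw [← Complex.re_sum, AddChar.sum_mulShift _ hψ]
  simp

/-- The minimum of the Gaussian periods is negative and is attained away from `0`. -/
theorem exists_gaussianPeriod_min (hψ : ψ.IsPrimitive) :
    ∃ b₀ : Fˣ, gaussianPeriod ψ H b₀ < 0 ∧ ∀ b, gaussianPeriod ψ H b₀ ≤ gaussianPeriod ψ H b := by
  have h0 : 0 < gaussianPeriod ψ H 0 := by
    rw [gaussianPeriod_zero]; exact_mod_cast Nat.card_pos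
  obtain ⟨b₀, hb₀⟩ := Finite.exists_min (gaussianPeriod ψ H)
  have hneg : gaussianPeriod ψ H b₀ < 0 := by
    -- The periods sum to zero while the one at `0` is positive.
    by_contra! hn
    exact (sum_pos' (fun b _ => hn.trans (hb₀ b)) ⟨0, mem_univ _, h0⟩).ne'
      (sum_gaussianPeriod hψ)
  have hne : b₀ ≠ 0 := by
    rintro rfl
    exact lt_asymm h0 hneg
  exact ⟨Units.mk0 b₀ hne, hneg, hb₀⟩

/-- The Fourier transform of the Gaussian periods is supported on `-H`. -/
theorem sum_gaussianPeriod_mul (hψ : ψ.IsPrimitive) (hH : -1 ∈ H) {t : F}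
    (ht : ∀ h ∈ H, t ≠ ((h : Fˣ) : F)) : ∑ b, gaussianPeriod ψ H b * (ψ (b * t)).re = 0 := by
  classical
  have key : ∑ b, (gaussianPeriod ψ H b : ℂ) * ψ (b * t) = 0 := by
    simp only [ofReal_gaussianPeriod hH, finsum_eq_sum_of_fintype, sum_mul,
      ← AddChar.map_add_eq_mul, ← mul_add]
    rw [sum_comm]
    refine sum_eq_zero fun h _ => ?_
    rw [AddChar.sum_mulShift _ hψ, if_neg, Nat.cast_zero]
    intro h'
    refine ht (-1 * h) (H.mul_mem hH h.2) ?_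
    push_cast
    linear_combination h'
  simpa using congrArg Complex.re key

theorem isPositiveCombination_add_gaussianPeriod (hH : -1 ∈ H) {m : ℝ} (hm : 0 ≤ m) (b : F) :
    IsPositiveCombination ψ (fun x => ((m + gaussianPeriod ψ H (b * x) : ℝ) : ℂ)) m := by
  classical
  simp only [Complex.ofReal_add, ofReal_gaussianPeriod hH, finsum_eq_sum_of_fintype]
  simpa [mul_right_comm] using (IsPositiveCombination.const (ψ := ψ) hm).add
    (IsPositiveCombination.sum univ
      fun (h : H) _ => IsPositiveCombination.char (ψ := ψ) (b * ((h : Fˣ) : F)))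

/-- If `-m` is a Gaussian period at a nonzero argument, the product over the cosets of `H` of the
functions `x ↦ m + η (b x)` is a multiple of the indicator function of `0`. -/
theorem card_mul_pow_index_le (hψ : ψ.IsPrimitive) (hH : -1 ∈ H) (b₀ : Fˣ) {m : ℝ} (hm : 0 ≤ m)
    (hb₀ : gaussianPeriod ψ H b₀ = -m) :
    Fintype.card F * m ^ H.index ≤ (m + Nat.card H) ^ H.index := by
  classical
  have hpos := (IsPositiveCombination.prod (univ : Finset (Fˣ ⧸ H)) hm fun g _ =>
    isPositiveCombination_add_gaussianPeriod (ψ := ψ) hH hm ((b₀ * g.out : Fˣ) : F)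
    ).card_mul_le_re_sum hψ
  rw [sum_eq_single 0] at hpos
  · simpa [← Complex.ofReal_natCast, ← Complex.ofReal_add, ← Complex.ofReal_pow,
      gaussianPeriod_zero, Subgroup.index_eq_card] using hpos
  · intro x _ hx
    have hx' : ((Units.mk0 x hx : Fˣ) : F) = x := rfl
    rw [← hx']
    generalize Units.mk0 x hx = y
    -- The factor of the coset of `y⁻¹` has argument `b₀ * h` with `h ∈ H`, where the period is
    -- `-m`.
    refine prod_eq_zero (mem_univ (QuotientGroup.mk (y⁻¹))) ?_
    obtain ⟨h, hh⟩ := QuotientGroup.mk_out_eq_mul H y⁻¹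
    rw [hh]
    have : ((b₀ * (y⁻¹ * h) : Fˣ) : F) * y = b₀ * (h : Fˣ) := by
      rw [← Units.val_mul, ← Units.val_mul]
      congr 1
      rw [mul_assoc, mul_right_comm, inv_mul_cancel, one_mul]
    rw [this, gaussianPeriod_mul h.2, hb₀]
    simp
  · simp

end GaussianPeriod

/-! ### Orthonormal representations and the strong product -/

section OrthonormalRepresentation

variable {V W : Type*} {G : SimpleGraph V} {G' : SimpleGraph W} {d d' : ℕ}
  {u : V → EuclideanSpace ℝ (Fin d)} {u' : W → EuclideanSpace ℝ (Fin d')}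
  {c : EuclideanSpace ℝ (Fin d)} {c' : EuclideanSpace ℝ (Fin d')} {s t : ℝ}

theorem IsOrthonormalRepresentation.lovaszTheta_le (hu : IsOrthonormalRepresentation G u)
    (hc : ‖c‖ = 1) (ht : 0 < t) (h : ∀ v, t⁻¹ ≤ inner ℝ c (u v) ^ 2) :
    lovaszTheta G ≤ ENNReal.ofReal t := by
  refine iInf₂_le_of_le d u <| iInf₂_le_of_le hu c <| iInf_le_of_le hc <| iSup_le fun v => ?_
  rw [ENNReal.inv_le_iff_inv_le, ← ENNReal.ofReal_inv_of_pos ht]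
  exact ENNReal.ofReal_le_ofReal (h v)

/-- The bound `α(G ⊠ G') ≤ ϑ(G) ϑ(G')`, stated for the values of two given representations. -/
theorem IsOrthonormalRepresentation.indepNum_strongProduct_le [Finite V] [Finite W]
    (hu : IsOrthonormalRepresentation G u) (hu' : IsOrthonormalRepresentation G' u')
    (hc : ‖c‖ = 1) (hc' : ‖c'‖ = 1) (hs : 0 < s) (ht : 0 < t)
    (h : ∀ v, s⁻¹ ≤ inner ℝ c (u v) ^ 2) (h' : ∀ v, t⁻¹ ≤ inner ℝ c' (u' v) ^ 2) :
    ((strongProduct G G').indepNum : ℝ) ≤ s * t := by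
  classical
  obtain ⟨S, hS, hcard⟩ := (strongProduct G G').exists_isNIndepSet_indepNum
  rw [← hcard]
  have hon : Orthonormal ℝ fun p : S => u p.1.1 ⊗ₜ[ℝ] u' p.1.2 := by
    refine ⟨fun p => by simp [hu.1, hu'.1], fun p q hpq => ?_⟩
    have hpq' : (p : V × W) ≠ q := fun e => hpq (Subtype.ext e)
    have hadj := hS p.2 q.2 hpq'
    simp only [strongProduct, not_or, not_and] at hadj
    change inner ℝ (u p.1.1 ⊗ₜ[ℝ] u' p.1.2) (u q.1.1 ⊗ₜ[ℝ] u' q.1.2) = 0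
    rw [TensorProduct.inner_tmul, mul_eq_zero]
    by_contra! hne
    have h1 : p.1.1 = q.1.1 ∨ G.Adj p.1.1 q.1.1 := by
      by_contra! hn
      exact hne.1 (hu.2 _ _ hn.1 hn.2)
    have h2 : p.1.2 = q.1.2 ∨ G'.Adj p.1.2 q.1.2 := by
      by_contra! hn
      exact hne.2 (hu'.2 _ _ hn.1 hn.2)
    have := @Prod.ext V W p.1 q.1
    tauto
  -- Bessel's inequality for the unit vector `c ⊗ c'` bounds the size of `S`.
  have hbessel := hon.sum_inner_products_le (s := univ) (c ⊗ₜ[ℝ] c')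
  simp only [TensorProduct.inner_tmul, TensorProduct.norm_tmul, hc, hc', Real.norm_eq_abs, sq_abs,
    mul_pow, one_pow, mul_one] at hbessel
  have hlow : (#S : ℝ) * (s⁻¹ * t⁻¹) ≤ 1 := by
    refine le_trans ?_ hbessel
    rw [← Fintype.card_coe S, ← nsmul_eq_mul]
    refine card_nsmul_le_sum _ _ _ fun p _ => ?_
    rw [real_inner_comm c, real_inner_comm c']
    exact mul_le_mul (h _) (h' _) (inv_nonneg.2 ht.le) (sq_nonneg _)
  rwa [← mul_inv, ← div_eq_mul_inv, div_le_one (mul_pos hs ht)] at hlow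

end OrthonormalRepresentation

/-! ### The representation of the Paley graph -/

/-- Vectors whose Gram matrix is a nonnegative combination of the real parts of the kernels
`ψ (b * (y - x))`, with a unit vector in the direction of the trivial character. -/
theorem exists_gram_eq_sum_char {R : Type*} [CommRing R] [Fintype R] (ψ : AddChar R ℂ) {w : R → ℝ}
    (hw : ∀ b, 0 ≤ w b) :
    ∃ (d : ℕ) (u : R → EuclideanSpace ℝ (Fin d)) (c : EuclideanSpace ℝ (Fin d)), ‖c‖ = 1 ∧
      (∀ x y, inner ℝ (u x) (u y) = ∑ b, w b * (ψ (b * (y - x))).re) ∧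
      ∀ x, inner ℝ c (u x) ^ 2 = w 0 := by
  classical
  let : InnerProductSpace ℝ (EuclideanSpace ℂ R) := InnerProductSpace.complexToReal
  have : FiniteDimensional ℝ (EuclideanSpace ℂ R) := FiniteDimensional.complexToReal _
  have hinner (x y : EuclideanSpace ℂ R) : inner ℝ x y = (inner ℂ x y).re := rfl
  let e := (stdOrthonormalBasis ℝ (EuclideanSpace ℂ R)).repr
  refine ⟨_, fun x => e (WithLp.toLp 2 fun b => (√(w b) : ℂ) * ψ (b * x)),
    e (EuclideanSpace.single 0 1), ?_, fun x y => ?_, fun x => ?_⟩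
  · rw [e.norm_map]; simp
  · rw [e.inner_map_map, hinner, PiLp.inner_apply, Complex.re_sum]
    refine sum_congr rfl fun b _ => ?_
    have hsq : (√(w b) : ℂ) * √(w b) = (w b : ℂ) := by
      rw [← Complex.ofReal_mul, Real.mul_self_sqrt (hw b)]
    have : inner ℂ ((√(w b) : ℂ) * ψ (b * x)) ((√(w b) : ℂ) * ψ (b * y)) =
        (w b : ℂ) * ψ (b * (y - x)) := by
      rw [RCLike.inner_apply', mul_sub, sub_eq_add_neg, AddChar.map_add_eq_mul,
        AddChar.map_neg_eq_conj, map_mul, Complex.conj_ofReal, ← hsq]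
      ring
    change (inner ℂ ((√(w b) : ℂ) * ψ (b * x)) ((√(w b) : ℂ) * ψ (b * y))).re = _
    rw [this, Complex.re_ofReal_mul]
  · rw [e.inner_map_map, hinner, EuclideanSpace.inner_single_left]
    simp [Real.sq_sqrt (hw 0)]

/-- The unit group is cyclic, so the index is a gcd with `k`. -/
theorem index_range_powMonoidHom_units_le {F : Type*} [Field F] [Finite F] {k : ℕ} (hk : 1 ≤ k) :
    (powMonoidHom k : Fˣ →* Fˣ).range.index ≤ k := by
  rw [Subgroup.index_range, IsCyclic.card_powMonoidHom_ker]
  exact Nat.gcd_le_right _ hk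

/-- An orthonormal representation of the generalized Paley graph of value at most
`q ^ (1 - 1 / k)`. -/
theorem exists_representation_generalizedPaleyGraph {F : Type*} [Field F] [Fintype F] {k : ℕ}
    (hk : 1 ≤ k) (h : ∃ z : F, z ^ k = -1) :
    ∃ (d : ℕ) (u : F → EuclideanSpace ℝ (Fin d)) (c : EuclideanSpace ℝ (Fin d)),
      IsOrthonormalRepresentation (generalizedPaleyGraph k F h) u ∧ ‖c‖ = 1 ∧
      ∀ v, ((Fintype.card F : ℝ) ^ (1 - 1 / (k : ℝ)))⁻¹ ≤ inner ℝ c (u v) ^ 2 := by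
  classical
  set q : ℝ := (Fintype.card F : ℝ) with hq
  have hq0 : 0 < q := by rw [hq]; exact_mod_cast Fintype.card_pos
  have hk0 : k ≠ 0 := by lia
  let H : Subgroup Fˣ := (powMonoidHom k : Fˣ →* Fˣ).range
  have hH : -1 ∈ H := by
    obtain ⟨z, hz⟩ := h
    have hz0 : z ≠ 0 := by
      rintro rfl
      rw [zero_pow hk0] at hz
      exact neg_ne_zero.2 one_ne_zero hz.symm
    exact ⟨Units.mk0 z hz0, Units.ext (by simpa using hz)⟩
  let ψ := AddChar.FiniteField.primitiveChar_to_Complex F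
  have hψ : ψ.IsPrimitive := AddChar.FiniteField.primitiveChar_to_Complex_isPrimitive F
  obtain ⟨b₀, hneg, hmin⟩ := exists_gaussianPeriod_min (H := H) hψ
  obtain ⟨m, hm⟩ : ∃ m, m = -gaussianPeriod ψ H b₀ := ⟨_, rfl⟩
  have hm0 : 0 < m := by linarith
  have hprod := card_mul_pow_index_le hψ hH b₀ hm0.le (by rw [hm, neg_neg])
  set r : ℝ := (Nat.card H : ℝ)
  have hr0 : 0 ≤ r := Nat.cast_nonneg _
  -- the value `1 + r / m` is at least `q ^ (1 / k)`
  have hval : q ^ (1 / (k : ℝ)) ≤ 1 + r / m := by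
    have h1 : 1 ≤ 1 + r / m := le_add_of_nonneg_right (div_nonneg hr0 hm0.le)
    have h2 : q ≤ (1 + r / m) ^ k := by
      refine le_trans ?_ (pow_le_pow_right₀ h1 (index_range_powMonoidHom_units_le (F := F) hk))
      rw [one_add_div hm0.ne', div_pow, le_div_iff₀ (pow_pos hm0 _)]
      exact hprod
    rw [one_div]
    rw [← Real.pow_rpow_inv_natCast (zero_le_one.trans h1) hk0]
    exact Real.rpow_le_rpow hq0.le h2 (by positivity)
  -- The eigenvalues of `I + A / m`, divided by `q`; they are nonnegative by the minimality of `-m`.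
  let w : F → ℝ := fun b => (1 + gaussianPeriod ψ H b / m) / q
  have hw (b : F) : 0 ≤ w b := by
    refine div_nonneg ?_ hq0.le
    rw [one_add_div hm0.ne']
    refine div_nonneg ?_ hm0.le
    linarith [hmin b]
  obtain ⟨d, u, c, hc, hgram, hcu⟩ := exists_gram_eq_sum_char ψ hw
  have hsum (t : F) (ht : ∀ g ∈ H, t ≠ ((g : Fˣ) : F)) :
      ∑ b, w b * (ψ (b * t)).re = if t = 0 then 1 else 0 := by
    have h1 := sum_gaussianPeriod_mul hψ hH ht
    have h2 : ∑ b, (ψ (b * t)).re = if t = 0 then q else 0 := by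
      rw [← Complex.re_sum, AddChar.sum_mulShift t hψ]
      split_ifs <;> simp [hq]
    calc ∑ b, w b * (ψ (b * t)).re
        = (∑ b, (ψ (b * t)).re) / q + (∑ b, gaussianPeriod ψ H b * (ψ (b * t)).re) / (m * q) := by
          rw [sum_div, sum_div, ← sum_add_distrib]
          refine sum_congr rfl fun b _ => ?_
          simp only [w]
          field_simp
      _ = _ := by
          rw [h1, h2, zero_div, add_zero]
          split_ifs
          · exact div_self hq0.ne'
          · exact zero_div _
  refine ⟨d, u, c, ⟨fun v => ?_, fun v v' hne hadj => ?_⟩, hc, fun v => ?_⟩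
  · have := hgram v v
    rw [sub_self, hsum 0 fun g _ => g.ne_zero.symm, if_pos rfl, real_inner_self_eq_norm_sq] at this
    exact (pow_eq_one_iff_of_nonneg (norm_nonneg _) two_ne_zero).1 this
  · rw [hgram, hsum, if_neg (sub_ne_zero.2 hne.symm)]
    rintro g ⟨z, hz⟩ hg
    refine hadj (SimpleGraph.Adj.symm ⟨hne.symm, (z : F), ?_⟩)
    rw [hg, ← hz]
    simp
  · rw [hcu, Real.rpow_sub hq0, Real.rpow_one, inv_div]
    simp only [w, gaussianPeriod_zero]
    exact div_le_div_of_nonneg_right hval hq0.le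

theorem theorem2p3 {F : Type*} [Field F] [Fintype F] (k : ℕ) (hk : 1 ≤ k)
    (h : ∃ z : F, z ^ k = -1) :
    lovaszTheta (generalizedPaleyGraph k F h) ≤
        ENNReal.ofReal ((Fintype.card F : ℝ) ^ (1 - 1 / (k : ℝ))) ∧
      ((strongProduct (generalizedPaleyGraph k F h)
          (generalizedPaleyGraph k F h)).indepNum : ℝ) ≤
        (Fintype.card F : ℝ) ^ (2 * (1 - 1 / (k : ℝ))) := by
  obtain ⟨d, u, c, hu, hc, hval⟩ := exists_representation_generalizedPaleyGraph hk h
  have hq : (0 : ℝ) < Fintype.card F := by exact_mod_cast Fintype.card_pos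
  have ht := Real.rpow_pos_of_pos hq (1 - 1 / (k : ℝ))
  refine ⟨hu.lovaszTheta_le hc ht hval, ?_⟩
  rw [two_mul, Real.rpow_add hq]
  exact hu.indepNum_strongProduct_le hu hc hc ht ht hval hval
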